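/- Let $\Sigma=\{0,1\}$. Fix any pairing function, i.e. a total polynomial-time computable bijection $\langle\cdot,\cdot\rangle:\Sigma^*\times\Sigma^*\to\Sigma^*$ whose inverses (projections) $\pi_1,\pi_2:\Sigma^*\to\Sigma^*$, $\pi_1(\langle x,y\rangle)=x$, $\pi_2(\langle x,y\rangle)=y$, are polynomial-time computable. Let FP be the class of total polynomial-time computable functions. For a total function $\sigma:\Sigma^*\times\Sigma^*\to\Sigma^*$: - $\sigma$ is *honest* if there is a polynomial $q$ such that every $z\in\mathrm{image}(\sigma)$ has a preimage $(a,b)$ with $|a|+|b|\le q(|z|)$. - $\sigma$ is *one-way* if it is honest, polynomial-time computable, and there is no $g\in\mathrm{FP}$, $g:\Sigma^*\to\Sigma^*\times\Sigma^*$, with $\sigma(g(z))=z$ for all $z\in\mathrm{image}(\sigma)$. - $\sigma$ is *s-honest* if there is a polynomial $q$ such that (a) for all $z,a$ for which some $b$ satisfies $\sigma(a,b)=z$, there is $b'$ with $|b'|\le q(|z|+|a|)$ and $\sigma(a,b')=z$; and (b) for all $z,b$ for which some $a$ satisfies $\sigma(a,b)=z$, there is $a'$ with $|a'|\le q(|z|+|b|)$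 and $\sigma(a',b)=z$. - $\sigma$ is *invertible with respect to the first argument* if there is $g_1\in\mathrm{FP}$ such that $\sigma(a,g_1(\langle a,z\rangle))=z$ whenever $\sigma(a,b)=z$ for some $b$; it is *invertible with respect to the second argument* if there is $g_2\in\mathrm{FP}$ such that $\sigma(g_2(\langle b,z\rangle),b)=z$ whenever $\sigma(a,b)=z$ for some $a$. - $\sigma$ is *strongly one-way* if it is s-honest, polynomial-time computable, and invertible neither with respect to the first nor with respect to the second argument. **Theorem.** Assume $\mathrm{P}\ne\mathrm{NP}$. Then there is a total, s-honest 2-ary one-way function that is invertible with respect to its first argument but not with respect to its second argument, and there is a total, s-honest 2-ary one-way function that is invertible with respect to its second argument but not with respect to its first argument; in particular, neither function is strongly one-way. Moreover, for every total 2-ary one-way function $\rho$, the function $$\sigma(a,b)=\rho(\pi_1(b),\pi_2(b))$$ is a function of the second kind: it is a total, s-honest 2-ary one-way function, invertible with respect to its second argument but not with respect to its first argument, and hence not strongly one-way. -/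

import Mathlib

open Computability

/-- Strings over the binary alphabet. -/
abbrev Str : Type := List Bool

/-- A string is presented to a machine as itself. -/
abbrev strEnc : Encoding Str Bool := encodingList Bool

/-- A pair of strings `(a, b)` is presented to a machine as `a` followed by `b`, the symbols of the
two components being marked differently; the length of this presentation is `|a| + |b|`. -/
abbrev pairEnc : Encoding (Str × Str) (Bool ⊕ Bool) := encodingProd strEnc strEnc

/-- The total function `f` is computed by a multi-stack Turing machine in a number of steps that
is polynomially bounded in the length of the (encoded) input. -/
def PolyTime {α β A B : Type} (ea : Encoding α A) (eb : Encoding β B) (f : α → β) : Prop :=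
  Nonempty (Turing.TM2ComputableInPolyTime ea.encode eb.encode f)

/-- The set `S` is decidable in polynomial time. -/
def PolyTimeDecidable {α A : Type} (ea : Encoding α A) (S : Set α) : Prop :=
  ∃ d : α → Bool, PolyTime ea encodingBoolBool d ∧ ∀ x, x ∈ S ↔ d x = true

/-- The complexity class P. -/
def ClassP : Set (Set Str) := {L | PolyTimeDecidable strEnc L}

/-- The complexity class NP: membership has witnesses of polynomially bounded length that can be
checked in polynomial time. -/
def ClassNP : Set (Set Str) :=
  {L | ∃ R : Set (Str × Str), PolyTimeDecidable pairEnc R ∧ ∃ q : Polynomial ℕ,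
    ∀ x, x ∈ L ↔ ∃ w : Str, w.length ≤ q.eval x.length ∧ (x, w) ∈ R}

/-- A pairing function: a polynomial-time computable bijection from pairs of strings to strings
with polynomial-time computable inverses (projections). -/
structure PairingFunction where
  toEquiv : Str × Str ≃ Str
  polyTime_pair : PolyTime pairEnc strEnc toEquiv
  polyTime_fst : PolyTime strEnc strEnc fun w => (toEquiv.symm w).1
  polyTime_snd : PolyTime strEnc strEnc fun w => (toEquiv.symm w).2

namespace PairingFunction

/-- The string that codes the pair `(a, b)`. -/
def pair (p : PairingFunction) (a b : Str) : Str := p.toEquiv (a, b)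

/-- The first projection. -/
def proj₁ (p : PairingFunction) (w : Str) : Str := (p.toEquiv.symm w).1

/-- The second projection. -/
def proj₂ (p : PairingFunction) (w : Str) : Str := (p.toEquiv.symm w).2

end PairingFunction

/-- Honesty of a total 2-ary function. -/
def Honest (ρ : Str × Str → Str) : Prop :=
  ∃ q : Polynomial ℕ, ∀ z ∈ Set.range ρ, ∃ a b : Str,
    a.length + b.length ≤ q.eval z.length ∧ ρ (a, b) = z

/-- A total 2-ary function is noninvertible if no polynomial-time computable total function maps
every image element to a preimage. -/
def Noninvertible (ρ : Str × Str → Str) : Prop :=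
  ¬ ∃ g : Str → Str × Str, PolyTime strEnc pairEnc g ∧ ∀ z ∈ Set.range ρ, ρ (g z) = z

/-- Total 2-ary one-way functions. -/
def OneWay (ρ : Str × Str → Str) : Prop :=
  Honest ρ ∧ PolyTime pairEnc strEnc ρ ∧ Noninvertible ρ

/-- s-honesty of a total 2-ary function. -/
def SHonest (σ : Str × Str → Str) : Prop :=
  ∃ q : Polynomial ℕ,
    (∀ z a : Str, (∃ b, σ (a, b) = z) →
      ∃ b' : Str, b'.length ≤ q.eval (z.length + a.length) ∧ σ (a, b') = z) ∧
    (∀ z b : Str, (∃ a, σ (a, b) = z) →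
      ∃ a' : Str, a'.length ≤ q.eval (z.length + b.length) ∧ σ (a', b) = z)

/-- Invertibility with respect to the first argument: the first argument is given, and a second
argument is to be found. -/
def InvertibleFirst (p : PairingFunction) (σ : Str × Str → Str) : Prop :=
  ∃ g₁ : Str → Str, PolyTime strEnc strEnc g₁ ∧
    ∀ z ∈ Set.range σ, ∀ a b : Str, σ (a, b) = z → σ (a, g₁ (p.pair a z)) = z

/-- Invertibility with respect to the second argument: the second argument is given, and a first
argument is to be found. -/
def InvertibleSecond (p : PairingFunction) (σ : Str × Str → Str) : Prop :=
  ∃ g₂ : Str → Str, PolyTime strEnc strEnc g₂ ∧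
    ∀ z ∈ Set.range σ, ∀ a b : Str, σ (a, b) = z → σ (g₂ (p.pair b z), b) = z

/-- Strong noninvertibility. -/
def StronglyNoninvertible (p : PairingFunction) (σ : Str × Str → Str) : Prop :=
  ¬ InvertibleFirst p σ ∧ ¬ InvertibleSecond p σ

/-- Total strongly one-way functions. -/
def StronglyOneWay (p : PairingFunction) (σ : Str × Str → Str) : Prop :=
  SHonest σ ∧ PolyTime pairEnc strEnc σ ∧ StronglyNoninvertible p σ

/-! If L lies in NP but not in P, let ρ(x, w) be x with a leading 1 when w is a witness for x within
the length bound, and the empty word otherwise. The length bound makes ρ honest. An inverter applied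
to 1x yields a candidate witness for x, and checking it would decide L, so ρ is one-way
(`exists_oneWay`).

Given a one-way ρ, let σ ignore its first argument and apply ρ to the pair coded by the second.
Given the second argument, every first argument works, so inversion is trivial. Given the first, one
learns nothing and must find a code of a ρ-preimage, which decodes to an inversion of ρ
(`oneWay_comp_snd`). Exchanging the arguments gives the other kind (`oneWay_comp_fst`).

The bulk of the file supplies the closure properties of polynomial time that this takes for granted:
composition (`PolyTime.comp`), pairing (`PolyTime.prodMk`), finite-state transductions, and
polynomial length bounds in unary. For them a small language of stack programs is set up, with
sequencing, loops and explicit running times. -/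

open Turing Function

/-- A program acting on a family of stacks, without distinguished input and output stacks. -/
structure StackProg {K : Type} (Γ : K → Type) where
  Λ : Type
  σ : Type
  [finΛ : Finite Λ]
  [finσ : Finite σ]
  main : Λ
  init : σ
  m : Λ → TM2.Stmt Γ Λ σ

namespace StackProg

attribute [instance] finΛ finσ

section Steps

variable {K : Type} [DecidableEq K] {Γ : K → Type} {Λ σ : Type}

/-- `Steps m n c c'`: exactly `n` steps of the machine `m` lead from `c` to `c'`. -/
inductive Steps (m : Λ → TM2.Stmt Γ Λ σ) : ℕ → TM2.Cfg Γ Λ σ → TM2.Cfg Γ Λ σ → Prop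
  | refl (c) : Steps m 0 c c
  | head {n l v S c} : Steps m n (TM2.stepAux (m l) v S) c → Steps m (n + 1) ⟨some l, v, S⟩ c

theorem Steps.trans {m : Λ → TM2.Stmt Γ Λ σ} {a b : ℕ} {c₁ c₂ c₃ : TM2.Cfg Γ Λ σ}
    (h₁ : Steps m a c₁ c₂) (h₂ : Steps m b c₂ c₃) : Steps m (a + b) c₁ c₃ := by
  induction h₁ with
  | refl => simpa using h₂
  | head _ ih => rw [Nat.add_right_comm]; exact .head (ih h₂)

theorem iterate_bind_none (m : Λ → TM2.Stmt Γ Λ σ) (n : ℕ) :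
    (flip bind (TM2.step m))^[n] none = none := by
  induction n with
  | zero => rfl
  | succ n ih => rw [iterate_succ_apply]; exact ih

/-- Links the inductive relation, convenient for gluing runs, to the iteration that occurs in
`TM2ComputableInPolyTime`. -/
theorem steps_iff (m : Λ → TM2.Stmt Γ Λ σ) (n : ℕ) (c c' : TM2.Cfg Γ Λ σ) :
    Steps m n c c' ↔ (flip bind (TM2.step m))^[n] (some c) = some c' := by
  constructor
  · intro h
    induction h with
    | refl => rfl
    | head _ ih => rw [iterate_succ_apply]; exact ih
  · intro h
    induction n generalizing c with
    | zero =>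
      obtain rfl : c = c' := by simpa using h
      exact .refl c
    | succ n ih =>
      rw [iterate_succ_apply] at h
      obtain ⟨_ | l, v, S⟩ := c
      · have : (flip bind (TM2.step m)) (some ⟨none, v, S⟩) = none := rfl
        rw [this, iterate_bind_none] at h
        exact absurd h (by simp)
      · exact .head (ih _ h)

end Steps

/-! ### Embedding one machine into another -/

section Embed

variable {K : Type} [DecidableEq K] {Γ : K → Type} {Λ Λ' σ σ' : Type}

/-- Translate a statement along an embedding of labels and a lens on the internal states;
halting becomes `exit`. -/
def trStmt (j : Λ → Λ') (get : σ' → σ) (set : σ → σ' → σ') (exit : TM2.Stmt Γ Λ' σ') :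
    TM2.Stmt Γ Λ σ → TM2.Stmt Γ Λ' σ'
  | .push k f q => .push k (fun v => f (get v)) (trStmt j get set exit q)
  | .peek k f q => .peek k (fun v s => set (f (get v) s) v) (trStmt j get set exit q)
  | .pop k f q => .pop k (fun v s => set (f (get v) s) v) (trStmt j get set exit q)
  | .load f q => .load (fun v => set (f (get v)) v) (trStmt j get set exit q)
  | .branch f q₁ q₂ =>
    .branch (fun v => f (get v)) (trStmt j get set exit q₁) (trStmt j get set exit q₂)
  | .goto f => .goto fun v => j (f (get v))
  | .halt => exit

variable {j : Λ → Λ'} {get : σ' → σ} {set : σ → σ' → σ'} {exit : TM2.Stmt Γ Λ' σ'}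

/-- The hypotheses are the lens laws: one statement may change the internal state several times, and
these changes have to collapse into a single `set`. -/
theorem stepAux_trStmt (hgs : ∀ x v, get (set x v) = x) (hss : ∀ x y v, set x (set y v) = set x v)
    (hsg : ∀ v, set (get v) v = v) (q : TM2.Stmt Γ Λ σ) (v : σ') (S : ∀ k, List (Γ k)) :
    TM2.stepAux (trStmt j get set exit q) v S =
      match TM2.stepAux q (get v) S with
      | ⟨some l, x, T⟩ => ⟨some (j l), set x v, T⟩
      | ⟨none, x, T⟩ => TM2.stepAux exit (set x v) T := by
  induction q generalizing v S with
  | push k f q ih => exact ih _ _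
  | peek k f q ih => simp only [trStmt, TM2.stepAux, ih, hgs, hss]
  | pop k f q ih => simp only [trStmt, TM2.stepAux, ih, hgs, hss]
  | load f q ih => simp only [trStmt, TM2.stepAux, ih, hgs, hss]
  | branch f q₁ q₂ ih₁ ih₂ =>
    simp only [trStmt, TM2.stepAux]
    cases f (get v)
    · exact ih₂ _ _
    · exact ih₁ _ _
  | goto f => simp only [trStmt, TM2.stepAux, hsg]
  | halt => simp only [trStmt, TM2.stepAux, hsg]

/-- The code in `exit` is executed within the step that used to halt, so the number of steps does
not change. -/
theorem steps_trStmt (hgs : ∀ x v, get (set x v) = x) (hss : ∀ x y v, set x (set y v) = set x v)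
    (hsg : ∀ v, set (get v) v = v) {m : Λ → TM2.Stmt Γ Λ σ} {m' : Λ' → TM2.Stmt Γ Λ' σ'}
    (hm : ∀ l, m' (j l) = trStmt j get set exit (m l)) {n : ℕ} {c : TM2.Cfg Γ Λ σ} {x : σ}
    {T : ∀ k, List (Γ k)} (h : Steps m n c ⟨none, x, T⟩) :
    ∀ l, c.l = some l → ∀ v, get v = c.var →
      Steps m' n ⟨some (j l), v, c.stk⟩ (TM2.stepAux exit (set x v) T) := by
  generalize hc : (⟨none, x, T⟩ : TM2.Cfg Γ Λ σ) = c' at h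
  induction h with
  | refl c => subst hc; rintro l ⟨⟩
  | @head n l v S c h ih =>
    subst hc
    rintro _ ⟨⟩ w hw
    refine .head ?_
    simp only at hw
    rw [hm, stepAux_trStmt hgs hss hsg, hw]
    have ih := ih rfl
    revert h ih
    obtain ⟨l', y, U⟩ := TM2.stepAux (m l) v S
    cases l' with
    | none =>
      rintro ⟨⟩ -
      exact .refl _
    | some l' =>
      intro _ ih
      have := ih l' rfl (set y w) (hgs _ _)
      rwa [hss] at this

end Embed

/-! ### Structured programs: sequencing, branching, loops -/

variable {K : Type} [DecidableEq K] {Γ : K → Type}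

/-- The program `P` transforms the stacks `S` into `S'` in at most `t` steps. -/
def Runs (P : StackProg Γ) (S S' : ∀ k, List (Γ k)) (t : ℕ) : Prop :=
  -- The internal state must return to `init`, so that a program can be run again inside a loop;
  -- `haltList` asks for the same.
  ∃ n ≤ t, Steps P.m n ⟨some P.main, P.init, S⟩ ⟨none, P.init, S'⟩

theorem Runs.mono {P : StackProg Γ} {S S' : ∀ k, List (Γ k)} {t u : ℕ} (h : P.Runs S S' t)
    (htu : t ≤ u) : P.Runs S S' u :=
  let ⟨n, hn, h⟩ := h
  ⟨n, hn.trans htu, h⟩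

/-- The program that does nothing. -/
def skip : StackProg Γ where
  Λ := Unit
  σ := Unit
  main := ()
  init := ()
  m _ := .halt

theorem runs_skip (S : ∀ k, List (Γ k)) : (skip : StackProg Γ).Runs S S 1 :=
  ⟨1, le_rfl, .head (.refl _)⟩

/-- Push the symbols of `w` one after the other. -/
def pushes (k : K) (w : List (Γ k)) : StackProg Γ where
  Λ := Unit
  σ := Unit
  main := ()
  init := ()
  m _ := w.foldr (fun a q => .push k (fun _ => a) q) .halt

theorem runs_pushes (k : K) (w : List (Γ k)) (S : ∀ k, List (Γ k)) :
    (pushes k w).Runs S (update S k (w.reverse ++ S k)) 1 := by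
  refine ⟨1, le_rfl, .head ?_⟩
  have : TM2.stepAux ((pushes k w).m ()) () S = ⟨none, (), update S k (w.reverse ++ S k)⟩ := by
    simp only [pushes]
    induction w generalizing S with
    | nil => simp [TM2.stepAux]
    | cons a w ih => simp only [List.foldr_cons, TM2.stepAux]; rw [ih]; simp
  exact this ▸ .refl _

theorem runs_pushes_of_eq {k : K} {w : List (Γ k)} {S S' : ∀ k, List (Γ k)}
    (h₀ : S' k = w.reverse ++ S k) (h₁ : ∀ i, i ≠ k → S' i = S i) : (pushes k w).Runs S S' 1 := by
  convert runs_pushes k w S using 1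
  exact eq_update_iff.2 ⟨h₀, h₁⟩

/-- Run `P` and then `Q`. -/
def seq (P Q : StackProg Γ) : StackProg Γ where
  Λ := P.Λ ⊕ Q.Λ
  σ := P.σ × Q.σ
  main := .inl P.main
  init := (P.init, Q.init)
  m := Sum.elim
    (fun l => trStmt .inl Prod.fst (fun x v => (x, v.2)) (.goto fun _ => .inr Q.main) (P.m l))
    (fun l => trStmt .inr Prod.snd (fun x v => (v.1, x)) .halt (Q.m l))

theorem Runs.seq {P Q : StackProg Γ} {S₁ S₂ S₃ : ∀ k, List (Γ k)} {t u : ℕ}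
    (hP : P.Runs S₁ S₂ t) (hQ : Q.Runs S₂ S₃ u) : (P.seq Q).Runs S₁ S₃ (t + u) := by
  obtain ⟨a, ha, hP⟩ := hP
  obtain ⟨b, hb, hQ⟩ := hQ
  refine ⟨a + b, by omega, ?_⟩
  have h₁ := steps_trStmt (m' := (P.seq Q).m) (j := Sum.inl) (get := Prod.fst)
    (set := fun x v => (x, v.2)) (exit := .goto fun _ => .inr Q.main) (by simp) (by simp) (by simp)
    (fun _ => rfl) hP _ rfl (P.init, Q.init) rfl
  have h₂ := steps_trStmt (m' := (P.seq Q).m) (j := Sum.inr) (get := Prod.snd)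
    (set := fun x v => (v.1, x)) (exit := .halt) (by simp) (by simp) (by simp)
    (fun _ => rfl) hQ _ rfl (P.init, Q.init) rfl
  exact h₁.trans h₂

section Branch

variable (k : K) [Finite (Γ k)] (body : Option (Γ k) → StackProg Γ) (again : Option (Γ k) → Bool)

open scoped Classical in
/-- Pop from the stack `k`, run the body that belongs to the result, and start again if `again`
says so. -/
noncomputable def branch : StackProg Γ where
  Λ := Unit ⊕ Σ o, (body o).Λ
  σ := (∀ o, (body o).σ) × Option (Γ k)
  main := .inl ()
  init := (fun o => (body o).init, none)
  m := Sum.elim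
    (fun _ => .pop k (fun v s => (v.1, s)) (.goto fun v => .inr ⟨v.2, (body v.2).main⟩))
    (fun l => trStmt (fun l' => .inr ⟨l.1, l'⟩) (fun v => v.1 l.1)
      (fun x v => (update v.1 l.1 x, v.2))
      -- Forgetting the popped symbol restores the initial state before the next round or the halt.
      (.load (fun v => (v.1, none)) (bif again l.1 then .goto fun _ => .inl () else .halt))
      ((body l.1).m l.2))

variable {k body again} {S S' : ∀ k, List (Γ k)} {t : ℕ}

theorem branch_aux (h : (body (S k).head?).Runs (update S k (S k).tail) S' t) :
    ∃ n ≤ t + 1, Steps (branch k body again).m n ⟨some (.inl ()), (branch k body again).init, S⟩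
      (TM2.stepAux (bif again (S k).head? then .goto fun _ => .inl () else .halt)
        (branch k body again).init S') := by
  classical
  obtain ⟨n, hn, h⟩ := h
  refine ⟨n + 1, by omega, .head ?_⟩
  have := steps_trStmt (m' := (branch k body again).m)
    (j := fun l' => .inr ⟨(S k).head?, l'⟩) (get := fun v => v.1 (S k).head?)
    (set := fun x v => (update v.1 (S k).head? x, v.2))
    (exit := .load (fun v => (v.1, none))
      (bif again (S k).head? then .goto fun _ => .inl () else .halt))
    (by simp) (by simp) (by simp) (fun l => by simp only [branch, Sum.elim_inr])
    h _ rfl (fun o => (body o).init, (S k).head?) rfl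
  simpa [branch] using this

theorem runs_branch (h : (body (S k).head?).Runs (update S k (S k).tail) S' t)
    (ha : again (S k).head? = false) : (branch k body again).Runs S S' (t + 1) := by
  obtain ⟨n, hn, h⟩ := branch_aux (again := again) h
  rw [ha] at h
  exact ⟨n, hn, h⟩

theorem runs_branch_again {S'' : ∀ k, List (Γ k)} {u : ℕ}
    (h : (body (S k).head?).Runs (update S k (S k).tail) S' t) (ha : again (S k).head? = true)
    (h' : (branch k body again).Runs S' S'' u) :
    (branch k body again).Runs S S'' (t + 1 + u) := by
  obtain ⟨n, hn, h⟩ := branch_aux (again := again) h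
  obtain ⟨n', hn', h'⟩ := h'
  rw [ha] at h
  exact ⟨n + n', by omega, h.trans h'⟩

end Branch

section Loop

variable (k : K) [Finite (Γ k)]

/-- Pop a symbol from the stack `k` and run the body that belongs to it, until `k` is empty. -/
noncomputable def loop (body : Γ k → StackProg Γ) : StackProg Γ :=
  branch k (fun o => o.elim skip body) Option.isSome

/-- Pop from the stack `k` and run the body that belongs to the result. -/
noncomputable def cases (body : Option (Γ k) → StackProg Γ) : StackProg Γ :=
  branch k body fun _ => false

variable {k}

theorem runs_cases {body : Option (Γ k) → StackProg Γ} {S S' : ∀ k, List (Γ k)} {t : ℕ}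
    (h : (body (S k).head?).Runs (update S k (S k).tail) S' t) :
    (cases k body).Runs S S' (t + 1) :=
  runs_branch h rfl

/-- Loops act as folds: `F s l` are the stacks when the accumulated value is `s` and `l` is still
to be read. -/
theorem runs_loop {ι : Type*} {body : Γ k → StackProg Γ} (F : ι → List (Γ k) → ∀ k, List (Γ k))
    (f : ι → Γ k → ι) {t : ℕ} (hF : ∀ s l, F s l k = l) (I : ι → List (Γ k) → Prop)
    (hI : ∀ s a l, I s (a :: l) → I (f s a) l)
    (h : ∀ s a l, I s (a :: l) → (body a).Runs (update (F s (a :: l)) k l) (F (f s a) l) t)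
    (l : List (Γ k)) (s : ι) (hs : I s l) :
    -- Each symbol costs one step for the pop and `t` for the body; the last 2 are the pop from the
    -- empty stack and `skip`.
    (loop k body).Runs (F s l) (F (l.foldl f s) []) ((t + 1) * l.length + 2) := by
  induction l generalizing s with
  | nil =>
    have := runs_branch (k := k) (body := fun o => o.elim skip body) (again := Option.isSome)
      (S := F s []) (S' := F s []) (t := 1) (by
        simp only [hF, List.head?_nil, Option.elim_none, List.tail_nil]
        have : update (F s []) k [] = F s [] := by rw [← hF s [], hF, update_eq_self_iff, hF]
        rw [this]
        exact runs_skip _) (by simp [hF])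
    exact this.mono (by omega)
  | cons a l ih =>
    refine (runs_branch_again (S' := F (f s a) l) (t := t) ?_ (by simp [hF])
      (ih (f s a) (hI _ _ _ hs))).mono ?_
    · simpa [hF] using h s a l hs
    · simp only [List.length_cons]; ring_nf; omega

/-- Suffices when the cost of the body does not depend on the accumulated value; the nested loop in
`runs_mul` needs the invariant. -/
theorem runs_loop' {ι : Type*} {body : Γ k → StackProg Γ} (F : ι → List (Γ k) → ∀ k, List (Γ k))
    (f : ι → Γ k → ι) {t : ℕ} (hF : ∀ s l, F s l k = l)
    (h : ∀ s a l, (body a).Runs (update (F s (a :: l)) k l) (F (f s a) l) t)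
    (l : List (Γ k)) (s : ι) :
    (loop k body).Runs (F s l) (F (l.foldl f s) []) ((t + 1) * l.length + 2) :=
  runs_loop F f hF (fun _ _ => True) (fun _ _ _ _ => trivial) (fun s a l _ => h s a l) l s trivial

end Loop

/-! ### Running a program on some of the stacks -/

section Lift

variable {K' : Type} [DecidableEq K'] {Γ' : K' → Type} (e : K → K')

/-- Rename the stacks of a statement. -/
def liftStmt {Λ σ : Type} : TM2.Stmt (fun k => Γ' (e k)) Λ σ → TM2.Stmt Γ' Λ σ
  | .push k f q => .push (e k) f (liftStmt q)
  | .peek k f q => .peek (e k) f (liftStmt q)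
  | .pop k f q => .pop (e k) f (liftStmt q)
  | .load f q => .load f (liftStmt q)
  | .branch f q₁ q₂ => .branch f (liftStmt q₁) (liftStmt q₂)
  | .goto f => .goto f
  | .halt => .halt

/-- Run a program on a part of the stacks. -/
def lift (P : StackProg fun k => Γ' (e k)) : StackProg Γ' where
  Λ := P.Λ
  σ := P.σ
  main := P.main
  init := P.init
  m l := liftStmt e (P.m l)

variable {e}

theorem stepAux_liftStmt (he : Injective e) {Λ σ : Type} (q : TM2.Stmt (fun k => Γ' (e k)) Λ σ)
    (v : σ) (S : ∀ k, List (Γ' k)) :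
    ∃ S' : ∀ k, List (Γ' k), TM2.stepAux (liftStmt e q) v S =
      ⟨(TM2.stepAux q v fun k => S (e k)).l, (TM2.stepAux q v fun k => S (e k)).var, S'⟩ ∧
      (TM2.stepAux q v fun k => S (e k)).stk = (fun k => S' (e k)) ∧
      ∀ k ∉ Set.range e, S' k = S k := by
  induction q generalizing v S with
  | push k f q ih =>
    obtain ⟨S', h₁, h₂, h₃⟩ := ih v (update S (e k) (f v :: S (e k)))
    rw [update_comp_eq_of_injective' S he] at h₁ h₂
    refine ⟨S', h₁, h₂, fun k' hk' => ?_⟩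
    rw [h₃ k' hk', update_of_ne (by rintro rfl; exact hk' ⟨k, rfl⟩)]
  | peek k f q ih => exact ih _ _
  | pop k f q ih =>
    obtain ⟨S', h₁, h₂, h₃⟩ := ih (f v (S (e k)).head?) (update S (e k) (S (e k)).tail)
    rw [update_comp_eq_of_injective' S he] at h₁ h₂
    refine ⟨S', h₁, h₂, fun k' hk' => ?_⟩
    rw [h₃ k' hk', update_of_ne (by rintro rfl; exact hk' ⟨k, rfl⟩)]
  | load f q ih => exact ih _ _
  | branch f q₁ q₂ ih₁ ih₂ =>
    simp only [liftStmt, TM2.stepAux]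
    cases f v
    · exact ih₂ _ _
    · exact ih₁ _ _
  | goto f => exact ⟨S, rfl, rfl, fun _ _ => rfl⟩
  | halt => exact ⟨S, rfl, rfl, fun _ _ => rfl⟩

theorem Runs.lift (he : Injective e) {P : StackProg fun k => Γ' (e k)} {S S' : ∀ k, List (Γ' k)}
    {t : ℕ} (h : P.Runs (fun k => S (e k)) (fun k => S' (e k)) t)
    (hS : ∀ k ∉ Set.range e, S' k = S k) : (P.lift e).Runs S S' t := by
  obtain ⟨n, hn, h⟩ := h
  refine ⟨n, hn, ?_⟩
  -- The final stacks stay fixed while the starting configuration varies; outside the range of `e`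
  -- the current stacks already equal the final ones.
  suffices H : ∀ (n : ℕ) (c : TM2.Cfg (fun k => Γ' (e k)) P.Λ P.σ) (T : ∀ k, List (Γ' k)),
      (∀ k, T (e k) = c.stk k) → (∀ k ∉ Set.range e, S' k = T k) →
      Steps P.m n c ⟨none, P.init, fun k => S' (e k)⟩ →
      Steps (P.lift e).m n ⟨c.l, c.var, T⟩ ⟨none, P.init, S'⟩ from
    H n _ S (fun _ => rfl) hS h
  intro n
  induction n with
  | zero =>
    rintro c T h₁ h₂ ⟨⟩
    have : T = S' := by
      funext k
      by_cases hk : k ∈ Set.range e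
      · obtain ⟨k, rfl⟩ := hk
        exact h₁ k
      · exact (h₂ k hk).symm
    rw [this]
    exact .refl _
  | succ n ih =>
    rintro c T h₁ h₂ h
    cases h with
    | @head _ l v U _ h =>
      obtain rfl : (fun k => T (e k)) = U := funext h₁
      obtain ⟨T', h₃, h₄, h₅⟩ := stepAux_liftStmt he (P.m l) v T
      refine .head ?_
      have : TM2.stepAux ((P.lift e).m l) v T = _ := h₃
      rw [this]
      exact ih _ T' (fun k => (congrFun h₄ k).symm) (fun k hk => (h₂ k hk).trans (h₅ k hk).symm) h

/-- If the stacks available to `P` are empty except for `k`, then so are they for the lifted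
program. -/
theorem Runs.lift_update (he : Injective e) {P : StackProg fun k => Γ' (e k)} {k k' : K}
    {l : List (Γ' (e k))} {l' : List (Γ' (e k'))} {S : ∀ k, List (Γ' k)} {t : ℕ}
    (hS : ∀ k, S (e k) = []) (h : P.Runs (update (fun _ => []) k l) (update (fun _ => []) k' l') t) :
    (P.lift e).Runs (update S (e k) l) (update S (e k') l') t := by
  apply Runs.lift he
  · rw [update_comp_eq_of_injective' S he, update_comp_eq_of_injective' S he]
    simpa only [hS] using h
  · intro i hi
    rw [update_of_ne (by rintro rfl; exact hi ⟨_, rfl⟩),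
      update_of_ne (by rintro rfl; exact hi ⟨_, rfl⟩)]

end Lift

section Move

variable {k k' : K} [Finite (Γ k)]

/-- Empty the stack `k`, pushing the images of its symbols onto `k'`. -/
noncomputable def move (k k' : K) [Finite (Γ k)] (h : Γ k → Γ k') : StackProg Γ :=
  loop k fun a => pushes k' [h a]

theorem runs_move (hk : k ≠ k') (h : Γ k → Γ k') {S S' : ∀ k, List (Γ k)} {t : ℕ}
    (h₀ : S' k = []) (h₁ : S' k' = ((S k).map h).reverse ++ S k')
    (h₂ : ∀ i, i ≠ k → i ≠ k' → S' i = S i) (ht : 2 * (S k).length + 2 ≤ t) :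
    (move k k' h).Runs S S' t := by
  have := runs_loop' (k := k) (body := fun a => pushes k' [h a])
    (fun (s : List (Γ k')) l => update (update S k l) k' s) (fun s a => h a :: s) (t := 1)
    (fun s l => by rw [update_of_ne hk, update_self])
    (fun s a l => by
      refine runs_pushes_of_eq ?_ ?_
      · simp [hk.symm]
      · intro i hi
        by_cases hi' : i = k
        · subst hi'; simp [hk]
        · simp [hi, hi']) (S k) (S k')
  have hf : ∀ (l : List (Γ k)) (s : List (Γ k')), l.foldl (fun s a => h a :: s) s = (l.map h).reverse ++ s := fun l => by
    induction l with
    | nil => simp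
    | cons a l ih => intro s; simp [ih]
  rw [hf, update_eq_self, update_eq_self] at this
  suffices S' = update (update S k []) k' (((S k).map h).reverse ++ S k') from
    this ▸ Runs.mono ‹_› ht
  funext i
  by_cases hi' : i = k'
  · subst hi'; simp [h₁]
  · by_cases hi : i = k
    · subst hi; simp [h₀, hk]
    · simp [hi, hi', h₂]

/-- Empty the stack `k`. -/
noncomputable def clear (k : K) [Finite (Γ k)] : StackProg Γ := loop k fun _ => skip

theorem runs_clear (S : ∀ k, List (Γ k)) :
    (clear k).Runs S (update S k []) (2 * (S k).length + 2) := by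
  have := runs_loop' (k := k) (body := fun _ => skip)
    (fun (_ : Unit) l => update S k l) (fun s _ => s) (t := 1)
    (fun s l => update_self ..)
    (fun s a l => by
      rw [update_idem]
      exact runs_skip _) (S k) ()
  rwa [update_eq_self] at this

end Move

end StackProg

namespace StackProg

/-! ### Output length is bounded by running time -/

section Length

variable {K : Type} [DecidableEq K] {Γ : K → Type}

/-- An upper bound on the number of symbols that a statement pushes. -/
def pushCount {Λ σ : Type} : TM2.Stmt Γ Λ σ → ℕ
  | .push _ _ q => pushCount q + 1
  | .peek _ _ q => pushCount q
  | .pop _ _ q => pushCount q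
  | .load _ q => pushCount q
  | .branch _ q₁ q₂ => pushCount q₁ + pushCount q₂
  | .goto _ => 0
  | .halt => 0

theorem length_stk_stepAux {Λ σ : Type} (q : TM2.Stmt Γ Λ σ) (v : σ) (S : ∀ k, List (Γ k)) (k : K) :
    ((TM2.stepAux q v S).stk k).length ≤ (S k).length + pushCount q := by
  induction q generalizing v S with
  | push i f q ih =>
    refine (ih v _).trans ?_
    by_cases h : k = i
    · subst h; simp [pushCount, Nat.add_assoc, Nat.add_comm 1]
    · simp [pushCount, update_of_ne h, ← Nat.add_assoc]
  | peek i f q ih => exact ih _ _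
  | pop i f q ih =>
    refine (ih _ _).trans ?_
    by_cases h : k = i
    · subst h; simp [pushCount]
    · simp [pushCount, update_of_ne h]
  | load f q ih => exact ih _ _
  | branch f q₁ q₂ ih₁ ih₂ =>
    simp only [TM2.stepAux, pushCount]
    cases f v
    · exact (ih₂ _ _).trans (by omega)
    · exact (ih₁ _ _).trans (by omega)
  | goto f => simp [pushCount]
  | halt => simp [pushCount]

/-- There are finitely many labels, so a single constant bounds the symbols pushed in one step. -/
theorem exists_length_le (P : StackProg Γ) : ∃ c : ℕ, ∀ S S' t, P.Runs S S' t →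
    ∀ k, (S' k).length ≤ (S k).length + c * t := by
  obtain ⟨c, hc⟩ := (Set.finite_range fun l => pushCount (P.m l)).bddAbove
  refine ⟨c, fun S S' t ⟨n, hn, h⟩ k => ?_⟩
  suffices H : ∀ n c₁ c₂, Steps P.m n c₁ c₂ → (c₂.stk k).length ≤ (c₁.stk k).length + c * n from
    (H _ _ _ h).trans (by gcongr)
  intro n c₁ c₂ h
  induction h with
  | refl => simp
  | @head n l v S c' _ ih =>
    have h₁ := length_stk_stepAux (P.m l) v S k
    have h₂ : pushCount (P.m l) ≤ c := hc ⟨l, rfl⟩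
    simp only [mul_add, mul_one]
    omega

end Length

/-- The program of a machine. -/
def ofFinTM2 (tm : FinTM2) : StackProg tm.Γ :=
  have := tm.ΛFin
  have := tm.σFin
  { Λ := tm.Λ, σ := tm.σ, main := tm.main, init := tm.initialState, m := tm.m }

end StackProg

/-! ### Between machines and stack programs -/

theorem Turing.initList_eq (tm : FinTM2) (s : List (tm.Γ tm.k₀)) :
    initList tm s = ⟨some tm.main, tm.initialState, update (fun _ => []) tm.k₀ s⟩ := by
  unfold initList
  congr 1
  funext k
  by_cases h : k = tm.k₀
  · subst h; simp
  · simp [h]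

theorem Turing.haltList_eq (tm : FinTM2) (s : List (tm.Γ tm.k₁)) :
    haltList tm s = ⟨none, tm.initialState, update (fun _ => []) tm.k₁ s⟩ := by
  unfold haltList
  congr 1
  funext k
  by_cases h : k = tm.k₁
  · subst h; simp
  · simp [h]

theorem Polynomial.eval_mono_nat (p : Polynomial ℕ) {a b : ℕ} (h : a ≤ b) :
    p.eval a ≤ p.eval b := by
  rw [Polynomial.eval_eq_sum_range, Polynomial.eval_eq_sum_range]
  gcongr

variable {α β γ A B C : Type} {ea : Encoding α A} {eb : Encoding β B} {ec : Encoding γ C}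

theorem PolyTime.exists_prog {f : α → β} (h : PolyTime ea eb f) :
    ∃ (K : Type) (_ : DecidableEq K) (_ : Fintype K) (Γ : K → Type) (k₀ k₁ : K) (i : A ≃ Γ k₀)
      (o : B ≃ Γ k₁) (_ : Finite A) (P : StackProg Γ) (p : Polynomial ℕ), ∀ a,
      P.Runs (update (fun _ => []) k₀ ((ea.encode a).map i))
        (update (fun _ => []) k₁ ((eb.encode (f a)).map o)) (p.eval (ea.encode a).length) := by
  obtain ⟨M⟩ := h
  have := M.tm.Γk₀Fin
  refine ⟨M.tm.K, M.tm.kDecidableEq, M.tm.kFin, M.tm.Γ, M.tm.k₀, M.tm.k₁, M.inputAlphabet.symm,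
    M.outputAlphabet.symm, .of_equiv _ M.inputAlphabet, .ofFinTM2 M.tm, M.time, fun a => ?_⟩
  obtain ⟨⟨n, h⟩, hn⟩ := M.outputsFun a
  refine ⟨n, hn, ?_⟩
  rw [Option.map_some, initList_eq, haltList_eq] at h
  exact (StackProg.steps_iff _ _ _ _).2 h

theorem PolyTime.of_prog {f : α → β} {K : Type} [DecidableEq K] [Fintype K] {Γ : K → Type}
    (k₀ k₁ : K) (i : A ≃ Γ k₀) (o : B ≃ Γ k₁) [Finite A] (P : StackProg Γ) (p : Polynomial ℕ)
    (h : ∀ a, P.Runs (update (fun _ => []) k₀ ((ea.encode a).map i))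
        (update (fun _ => []) k₁ ((eb.encode (f a)).map o)) (p.eval (ea.encode a).length)) :
    PolyTime ea eb f := by
  have : Finite (Γ k₀) := .of_equiv _ i
  have := Fintype.ofFinite (Γ k₀)
  have := Fintype.ofFinite P.Λ
  have := Fintype.ofFinite P.σ
  let tm : FinTM2 :=
    { K := K, k₀ := k₀, k₁ := k₁, Γ := Γ, Λ := P.Λ, main := P.main, σ := P.σ,
      initialState := P.init, m := P.m }
  refine ⟨⟨⟨tm, i.symm, o.symm⟩, p, fun a => ?_⟩⟩
  have h := h a
  refine ⟨⟨h.choose, ?_⟩, h.choose_spec.1⟩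
  rw [Option.map_some, initList_eq, haltList_eq]
  exact (StackProg.steps_iff _ _ _ _).1 h.choose_spec.2

theorem PolyTime.exists_length_le {f : α → β} (h : PolyTime ea eb f) :
    ∃ q : Polynomial ℕ, ∀ a, (eb.encode (f a)).length ≤ q.eval (ea.encode a).length := by
  obtain ⟨K, _, _, Γ, k₀, k₁, i, o, _, P, p, hP⟩ := h.exists_prog
  obtain ⟨c, hc⟩ := P.exists_length_le
  -- The summand `.X` is needed when input and output share a stack.
  refine ⟨.X + .C c * p, fun a => ?_⟩
  have h₁ := hc _ _ _ (hP a) k₁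
  have h₂ : (update (fun _ => []) k₀ ((ea.encode a).map i) k₁).length ≤ (ea.encode a).length := by
    by_cases h : k₁ = k₀
    · subst h; simp
    · simp [update_of_ne h]
  simp only [update_self, List.length_map] at h₁
  simp only [Polynomial.eval_add, Polynomial.eval_X, Polynomial.eval_mul, Polynomial.eval_C]
  omega

/-! ### Closure under composition and pairing -/

section Comp

variable {K₁ K₂ : Type} [DecidableEq K₁] [DecidableEq K₂] [Finite A] [Finite B]
  {a₁ b₁ : K₁} {a₂ b₂ : K₂} {p q : Polynomial ℕ}

/-- The two programs use disjoint stacks. The family `Γ` is a variable and the alphabets enter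
through equivalences, which keeps the proof free of case distinctions on stack types. -/
theorem PolyTime.comp_of_prog {g : β → γ} {f : α → β} {r : Polynomial ℕ}
    (hr : ∀ a, (eb.encode (f a)).length ≤ r.eval (ea.encode a).length)
    [Fintype K₁] [Fintype K₂] {Γ : (K₁ ⊕ K₂) ⊕ Unit → Type}
    (i₁ : A ≃ Γ (.inl (.inl a₁))) (o₁ : B ≃ Γ (.inl (.inl b₁)))
    (i₂ : B ≃ Γ (.inl (.inr a₂))) (o₂ : C ≃ Γ (.inl (.inr b₂))) (u : B ≃ Γ (.inr ()))
    (P : StackProg fun k => Γ (.inl (.inl k))) (Q : StackProg fun k => Γ (.inl (.inr k)))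
    (hP : ∀ a, P.Runs (update (fun _ => []) a₁ ((ea.encode a).map i₁))
      (update (fun _ => []) b₁ ((eb.encode (f a)).map o₁)) (p.eval (ea.encode a).length))
    (hQ : ∀ a, Q.Runs (update (fun _ => []) a₂ ((eb.encode a).map i₂))
      (update (fun _ => []) b₂ ((ec.encode (g a)).map o₂)) (q.eval (eb.encode a).length)) :
    PolyTime ea ec (fun a => g (f a)) := by
  have he₁ : Injective fun k : K₁ => (.inl (.inl k) : (K₁ ⊕ K₂) ⊕ Unit) :=
    Sum.inl_injective.comp Sum.inl_injective
  have he₂ : Injective fun k : K₂ => (.inl (.inr k) : (K₁ ⊕ K₂) ⊕ Unit) :=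
    Sum.inl_injective.comp Sum.inr_injective
  have : Finite (Γ (.inl (.inl b₁))) := .of_equiv _ o₁
  have : Finite (Γ (.inr ())) := .of_equiv _ u
  -- A move reverses a word, hence the detour over an auxiliary stack on the way from `P` to `Q`.
  let R : StackProg Γ := .seq (.seq (.seq (.lift (fun k => .inl (.inl k)) P)
    (.move (.inl (.inl b₁)) (.inr ()) fun x => u (o₁.symm x)))
    (.move (.inr ()) (.inl (.inr a₂)) fun x => i₂ (u.symm x))) (.lift (fun k => .inl (.inr k)) Q)
  refine .of_prog (.inl (.inl a₁)) (.inl (.inr b₂)) i₁ o₂ R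
    (p + (.C 2 * r + .C 2) + (.C 2 * r + .C 2) + q.comp r) fun a => ?_
  have h₁ := (hP a).lift_update (Γ' := Γ) (S := fun _ => []) he₁ fun _ => rfl
  have h₄ := (hQ (f a)).lift_update (Γ' := Γ) (S := fun _ => []) he₂ fun _ => rfl
  have hl := hr a
  have hq := q.eval_mono_nat hl
  refine (((h₁.seq (StackProg.runs_move
    (S' := update (fun _ => []) (.inr ()) ((eb.encode (f a)).reverse.map u))
    (t := 2 * r.eval (ea.encode a).length + 2) (by simp) _ (by simp)
    ?_ ?_ ?_)).seq (StackProg.runs_move (t := 2 * r.eval (ea.encode a).length + 2)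
    (by simp) _ (by simp) ?_ ?_ ?_)).seq h₄).mono ?_
  · simp [Function.comp_def]
  · intro i h₁ h₂; simp [h₁, h₂]
  · simpa using hl
  · simp [Function.comp_def]
  · intro i h₁ h₂; simp [h₁, h₂]
  · simpa using hl
  · simp only [Polynomial.eval_add, Polynomial.eval_mul, Polynomial.eval_C, Polynomial.eval_comp]
    omega

theorem PolyTime.prodMk_of_prog [Finite C] {f : α → β} {g : α → γ} {r s : Polynomial ℕ}
    (hr : ∀ a, (eb.encode (f a)).length ≤ r.eval (ea.encode a).length)
    (hs : ∀ a, (ec.encode (g a)).length ≤ s.eval (ea.encode a).length)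
    [Fintype K₁] [Fintype K₂] {Γ : (K₁ ⊕ K₂) ⊕ Fin 4 → Type}
    (i₁ : A ≃ Γ (.inl (.inl a₁))) (o₁ : B ≃ Γ (.inl (.inl b₁)))
    (i₂ : A ≃ Γ (.inl (.inr a₂))) (o₂ : C ≃ Γ (.inl (.inr b₂)))
    (u₀ : A ≃ Γ (.inr 0)) (u₁ : A ≃ Γ (.inr 1)) (u₂ : B ⊕ C ≃ Γ (.inr 2)) (u₃ : B ⊕ C ≃ Γ (.inr 3))
    (P : StackProg fun k => Γ (.inl (.inl k))) (Q : StackProg fun k => Γ (.inl (.inr k)))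
    (hP : ∀ a, P.Runs (update (fun _ => []) a₁ ((ea.encode a).map i₁))
      (update (fun _ => []) b₁ ((eb.encode (f a)).map o₁)) (p.eval (ea.encode a).length))
    (hQ : ∀ a, Q.Runs (update (fun _ => []) a₂ ((ea.encode a).map i₂))
      (update (fun _ => []) b₂ ((ec.encode (g a)).map o₂)) (q.eval (ea.encode a).length)) :
    PolyTime ea (encodingProd eb ec) (fun a => (f a, g a)) := by
  have he₁ : Injective fun k : K₁ => (.inl (.inl k) : (K₁ ⊕ K₂) ⊕ Fin 4) :=
    Sum.inl_injective.comp Sum.inl_injective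
  have he₂ : Injective fun k : K₂ => (.inl (.inr k) : (K₁ ⊕ K₂) ⊕ Fin 4) :=
    Sum.inl_injective.comp Sum.inr_injective
  have : Finite (Γ (.inl (.inl b₁))) := .of_equiv _ o₁
  have : Finite (Γ (.inl (.inr b₂))) := .of_equiv _ o₂
  have : Finite (Γ (.inr 0)) := .of_equiv _ u₀
  have : Finite (Γ (.inr 1)) := .of_equiv _ u₁
  have : Finite (Γ (.inr 2)) := .of_equiv _ u₂
  -- Of the four extra stacks, 0 holds the input, 1 its reversal, 2 the reversed output and 3 the
  -- output.
  let copy : StackProg Γ := .loop (.inr 1) fun x =>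
    .seq (.pushes (.inl (.inl a₁)) [i₁ (u₁.symm x)]) (.pushes (.inl (.inr a₂)) [i₂ (u₁.symm x)])
  let R : StackProg Γ := .seq (.seq (.seq (.seq (.seq (.seq
    (.move (.inr 0) (.inr 1) fun x => u₁ (u₀.symm x)) copy)
    (.lift (fun k => .inl (.inl k)) P)) (.lift (fun k => .inl (.inr k)) Q))
    (.move (.inl (.inl b₁)) (.inr 2) fun x => u₂ (.inl (o₁.symm x))))
    (.move (.inl (.inr b₂)) (.inr 2) fun x => u₂ (.inr (o₂.symm x))))
    (.move (.inr 2) (.inr 3) fun x => u₃ (u₂.symm x))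
  refine .of_prog (.inr 0) (.inr 3) u₀ u₃ R
    ((.C 2 * .X + .C 2) + (.C 3 * .X + .C 2) + p + q + (.C 2 * r + .C 2) + (.C 2 * s + .C 2) +
      (.C 2 * (r + s) + .C 2)) fun a => ?_
  obtain ⟨E, hE₀⟩ : ∃ E : ∀ k, List (Γ k), E = fun _ => [] := ⟨_, rfl⟩
  have hE : ∀ k, E k = [] := fun k => by rw [hE₀]
  have hE' : ∀ k, update E k [] = E := fun k => by rw [update_eq_self_iff, hE]
  rw [← hE₀]
  let n := (ea.encode a).length
  have h₁ : copy.Runs (update E (.inr 1) ((ea.encode a).reverse.map u₁))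
      (update (update E (.inl (.inr a₂)) ((ea.encode a).map i₂)) (.inl (.inl a₁))
        ((ea.encode a).map i₁)) (3 * n + 2) := by
    have := StackProg.runs_loop' (Γ := Γ) (k := .inr 1)
      (body := fun x => .seq (.pushes (.inl (.inl a₁)) [i₁ (u₁.symm x)])
        (.pushes (.inl (.inr a₂)) [i₂ (u₁.symm x)]))
      (fun s l => update (update (update E (.inr 1) l) (.inl (.inr a₂)) (s.map i₂))
        (.inl (.inl a₁)) (s.map i₁))
      (fun s x => u₁.symm x :: s) (t := 2)
      (fun s l => by simp)
      (fun s x l => by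
        refine (StackProg.runs_pushes _ _ _).seq (StackProg.runs_pushes_of_eq ?_ ?_)
        · simp
        · intro k hk
          rcases eq_or_ne k (.inl (.inl a₁)) with rfl | h₁
          · simp
          · rcases eq_or_ne k (.inr 1) with rfl | h₃
            · simp
            · simp [h₁, hk, h₃])
      ((ea.encode a).reverse.map u₁) []
    have hf : ((ea.encode a).reverse.map u₁).foldl (fun s x => u₁.symm x :: s) [] = ea.encode a := by
      simp
    rw [hf] at this
    convert this using 1
    · rw [List.map_nil, List.map_nil, update_comm (a := Sum.inr 1) (by simp), hE',
        update_comm (a := Sum.inr 1) (by simp), hE']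
    · rw [hE']
    · simp [n]
  have h₂ := (hP a).lift_update (Γ' := Γ) (S := update E (.inl (.inr a₂)) ((ea.encode a).map i₂))
    he₁ fun _ => by simp [hE]
  have h₃ := (hQ a).lift_update (Γ' := Γ)
    (S := update E (.inl (.inl b₁)) ((eb.encode (f a)).map o₁)) he₂ fun _ => by simp [hE]
  rw [update_comm (by simp)] at h₃
  have hl₁ := hr a
  have hl₂ := hs a
  refine ((((((StackProg.Runs.seq (StackProg.runs_move (t := 2 * n + 2) (by simp) _ (by simp [hE])
    ?_ ?_ ?_) h₁).seq h₂).seq h₃).seq (StackProg.runs_move (t := 2 * r.eval n + 2)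
      (S' := update (update E (.inr 2) ((eb.encode (f a)).reverse.map (u₂ ∘ .inl)))
        (.inl (.inr b₂)) ((ec.encode (g a)).map o₂))
      (by simp) _ (by simp [hE]) ?_ ?_ ?_)).seq (StackProg.runs_move (t := 2 * s.eval n + 2)
      (S' := update E (.inr 2) ((ec.encode (g a)).reverse.map (u₂ ∘ .inr) ++
        (eb.encode (f a)).reverse.map (u₂ ∘ .inl)))
      (by simp) _ (by simp [hE]) ?_ ?_ ?_)).seq
      (StackProg.runs_move (t := 2 * (r.eval n + s.eval n) + 2)
      (by simp) _ (by simp [hE]) ?_ ?_ ?_)).mono ?_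
  · simp [Function.comp_def, hE]
  · intro i h₁ h₂; simp [h₁, h₂, hE]
  · simp [n]
  · simp [Function.comp_def, hE]
  · intro i h₁ h₂
    rcases eq_or_ne i (.inl (.inr b₂)) with rfl | h₃
    · simp
    · simp [h₁, h₂, h₃]
  · simpa using hl₁
  · simp [Function.comp_def]
  · intro i h₁ h₂; simp [h₁, h₂, hE]
  · simpa using hl₂
  · simp [Function.comp_def, encodingProd, hE]
  · intro i h₁ h₂; simp [h₁, h₂, hE]
  · simp only [n, update_self, List.length_append, List.length_map, List.length_reverse]
    omega
  · simp only [Polynomial.eval_add, Polynomial.eval_mul, Polynomial.eval_C, Polynomial.eval_X]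
    exact le_rfl

end Comp

/-- Polynomial-time computable functions are closed under composition. -/
theorem PolyTime.comp {g : β → γ} {f : α → β} (hg : PolyTime eb ec g) (hf : PolyTime ea eb f) :
    PolyTime ea ec (fun a => g (f a)) := by
  obtain ⟨r, hr⟩ := hf.exists_length_le
  obtain ⟨K₁, _, _, Γ₁, a₁, b₁, i₁, o₁, _, P, p, hP⟩ := hf.exists_prog
  obtain ⟨K₂, _, _, Γ₂, a₂, b₂, i₂, o₂, _, Q, q, hQ⟩ := hg.exists_prog
  exact .comp_of_prog (Γ := Sum.elim (Sum.elim Γ₁ Γ₂) fun _ => B) hr i₁ o₁ i₂ o₂ (.refl _)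
    P Q hP hQ

/-- Pairs of polynomial-time computable functions are polynomial-time computable. -/
theorem PolyTime.prodMk [Finite B] [Finite C] {f : α → β} {g : α → γ} (hf : PolyTime ea eb f)
    (hg : PolyTime ea ec g) : PolyTime ea (encodingProd eb ec) (fun a => (f a, g a)) := by
  obtain ⟨r, hr⟩ := hf.exists_length_le
  obtain ⟨s, hs⟩ := hg.exists_length_le
  obtain ⟨K₁, _, _, Γ₁, a₁, b₁, i₁, o₁, _, P, p, hP⟩ := hf.exists_prog
  obtain ⟨K₂, _, _, Γ₂, a₂, b₂, i₂, o₂, _, Q, q, hQ⟩ := hg.exists_prog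
  exact .prodMk_of_prog (Γ := Sum.elim (Sum.elim Γ₁ Γ₂) fun i => if i < 2 then A else B ⊕ C) hr hs
    i₁ o₁ i₂ o₂ (.refl _) (.refl _) (.refl _) (.refl _) P Q hP hQ

namespace StackProg

/-! ### Transducers and unary arithmetic -/

section Machines

variable {Γ : Fin 4 → Type}

/-- Four stacks with the given contents. -/
def store (x : List (Γ 0)) (y : List (Γ 1)) (z : List (Γ 2)) (w : List (Γ 3)) : ∀ k, List (Γ k)
  | 0 => x
  | 1 => y
  | 2 => z
  | 3 => w

variable (x x' : List (Γ 0)) (y y' : List (Γ 1)) (z z' : List (Γ 2)) (w w' : List (Γ 3))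

@[simp] theorem store_zero : store x y z w 0 = x := rfl

@[simp] theorem store_one : store x y z w 1 = y := rfl

@[simp] theorem store_two : store x y z w 2 = z := rfl

@[simp] theorem store_three : store x y z w 3 = w := rfl

@[simp] theorem update_store_zero : update (store x y z w) 0 x' = store x' y z w := by
  funext k; fin_cases k <;> simp

@[simp] theorem update_store_one : update (store x y z w) 1 y' = store x y' z w := by
  funext k; fin_cases k <;> simp

@[simp] theorem update_store_two : update (store x y z w) 2 z' = store x y z' w := by
  funext k; fin_cases k <;> simp

@[simp] theorem update_store_three : update (store x y z w) 3 w' = store x y z w' := by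
  funext k; fin_cases k <;> simp

theorem store_nil : store (Γ := Γ) [] [] [] [] = fun _ => [] := by
  funext k; fin_cases k <;> simp

/-- The output of a finite-state transducer that is started in the state `q`: in each step a word
is written, and another one at the end. -/
def transduce {A B Q : Type} (δ : Q → A → Q × List B) (fin : Q → List B) : Q → List A → List B
  | q, [] => fin q
  | q, a :: w => (δ q a).2 ++ transduce δ fin (δ q a).1 w

/-- The program of a finite-state transducer. -/
noncomputable def transducer [Finite (Γ 0)] [Finite (Γ 1)] [Finite (Γ 2)]
    (δ : Γ 1 → Γ 0 → Γ 1 × List (Γ 2)) (fin : Γ 1 → List (Γ 2)) (q : Γ 1) (h : Γ 2 → Γ 3) :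
    StackProg Γ :=
  .seq (.seq (.seq (.pushes 1 [q])
    (.loop 0 fun a => .cases 1 fun o => o.elim .skip fun q =>
      .seq (.pushes 2 (δ q a).2) (.pushes 1 [(δ q a).1])))
    (.cases 1 fun o => o.elim .skip fun q => .pushes 2 (fin q))) (.move 2 3 h)

/-- Stack 1 holds the current state as its only symbol; stack 2 collects the output in reverse until
the final move. -/
theorem runs_transducer [Finite (Γ 0)] [Finite (Γ 1)] [Finite (Γ 2)]
    (δ : Γ 1 → Γ 0 → Γ 1 × List (Γ 2)) (fin : Γ 1 → List (Γ 2)) (q : Γ 1) (h : Γ 2 → Γ 3) :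
    (transducer δ fin q h).Runs (store x [] [] []) (store [] [] [] ((transduce δ fin q x).map h))
      (1 + (4 * x.length + 2) + 2 + (2 * (transduce δ fin q x).length + 2)) := by
  let f : Γ 1 × List (Γ 2) → Γ 0 → Γ 1 × List (Γ 2) :=
    fun s a => ((δ s.1 a).1, (δ s.1 a).2.reverse ++ s.2)
  have h₁ : (pushes 1 [q]).Runs (store x [] [] []) (store x [q] [] []) 1 := by
    simpa using runs_pushes 1 [q] (store x [] [] [])
  have h₂ := runs_loop' (k := 0) (body := fun a => .cases 1 fun o => o.elim .skip fun q =>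
      .seq (.pushes 2 (δ q a).2) (.pushes 1 [(δ q a).1]))
    (fun (s : Γ 1 × List (Γ 2)) l => store l [s.1] s.2 []) f (t := 3) (fun s l => rfl)
    (fun s a l => by
      refine runs_cases (t := 2) ?_
      have := (runs_pushes 2 (δ s.1 a).2 (store l [] s.2 [])).seq
        (runs_pushes 1 [(δ s.1 a).1] _)
      simpa [f] using this) x (q, [])
  have h₃ : ∀ x q z, (fin (x.foldl f (q, z)).1).reverse ++ (x.foldl f (q, z)).2 =
      (transduce δ fin q x).reverse ++ z := by
    intro x
    induction x with
    | nil => simp [transduce]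
    | cons a x ih => intro q z; simp [f, transduce, ih]
  refine ((h₁.seq h₂).seq (S₃ := store [] [] (transduce δ fin q x).reverse []) (u := 2)
    (runs_cases (t := 1) ?_)).seq (runs_move (by decide) _ (by simp) (by simp) ?_ (by simp))
  · have := runs_pushes 2 (fin (x.foldl f (q, [])).1) (store [] [] (x.foldl f (q, [])).2 [])
    have h₄ := h₃ x q []
    simp only [List.append_nil] at h₄
    simpa [h₄] using this
  · intro i h₁ h₂; fin_cases i <;> simp at h₁ h₂ ⊢

/-- Truncated subtraction in unary: subtract the number of symbols on the left from the number of
symbols on the right. -/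
noncomputable def monus [Finite (Γ 0)] [Finite (Γ 1)] (left : Γ 0 → Bool) (c : Γ 1) (d : Γ 3) :
    StackProg Γ :=
  .seq (.loop 0 fun a => if left a then .pushes 1 [c] else
    .cases 1 fun o => o.elim (.pushes 3 [d]) fun _ => .skip) (.clear 1)

/-- Each left symbol leaves a token on stack 1; each right symbol removes a token or, if none
remains, writes a symbol. -/
theorem runs_monus [Finite (Γ 0)] [Finite (Γ 1)] (left : Γ 0 → Bool) (c : Γ 1) (d : Γ 3)
    (x y : List (Γ 0)) (hx : ∀ a ∈ x, left a = true) (hy : ∀ a ∈ y, left a = false) :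
    (monus left c d).Runs (store (x ++ y) [] [] [])
      (store [] [] [] (.replicate (y.length - x.length) d))
      (3 * (x.length + y.length) + 2 + (2 * x.length + 2)) := by
  let f : ℕ × ℕ → Γ 0 → ℕ × ℕ := fun s a =>
    if left a then (s.1 + 1, s.2) else (s.1 - 1, s.2 + (1 - s.1))
  have h₁ := runs_loop' (k := 0) (body := fun a => if left a then .pushes 1 [c] else
      .cases 1 fun o => o.elim (.pushes 3 [d]) fun _ => .skip)
    (fun s l => store l (.replicate s.1 c) [] (.replicate s.2 d)) f (t := 2) (fun s l => rfl)
    (fun s a l => by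
      obtain ⟨n, m⟩ := s
      cases ha : left a
      · simp only [Bool.false_eq_true, if_false]
        refine runs_cases (t := 1) ?_
        cases n
        · simpa [f, ha, List.replicate_succ] using
            runs_pushes 3 [d] (store l [] [] (.replicate m d))
        · simpa [f, ha, List.replicate_succ] using runs_skip _
      · have := runs_pushes 1 [c] (store l (.replicate n c) [] (.replicate m d))
        simpa [f, ha, List.replicate_succ] using this.mono one_le_two) (x ++ y) (0, 0)
  have h₂ : ∀ x : List (Γ 0), (∀ a ∈ x, left a = true) → ∀ s : ℕ × ℕ, x.foldl f s = (s.1 + x.length, s.2) := by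
    intro x hx
    induction x with
    | nil => simp
    | cons a x ih =>
      intro s
      rw [List.foldl_cons, ih fun a h => hx a (by simp [h])]
      simp [f, hx]
      omega
  have h₃ : ∀ x : List (Γ 0), (∀ a ∈ x, left a = false) → ∀ s : ℕ × ℕ, x.foldl f s =
      (s.1 - x.length, s.2 + (x.length - s.1)) := by
    intro x hx
    induction x with
    | nil => simp
    | cons a x ih =>
      intro s
      rw [List.foldl_cons, ih fun a h => hx a (by simp [h])]
      simp [f, hx]
      omega
  rw [List.foldl_append, h₂ x hx, h₃ y hy] at h₁
  have h₄ := runs_clear (k := 1)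
    (store (Γ := Γ) [] (.replicate (x.length - y.length) c) [] (.replicate (y.length - x.length) d))
  refine (Runs.seq (S₂ := _) (by simpa using h₁) (by simpa using h₄)).mono ?_
  omega

/-- Multiplication in unary. -/
noncomputable def mul [Finite (Γ 0)] [Finite (Γ 1)] [Finite (Γ 2)] (left : Γ 0 → Bool) (c : Γ 1)
    (b : Γ 2) (d : Γ 3) : StackProg Γ :=
  .seq (.loop 0 fun a => if left a then .pushes 1 [c] else
    .seq (.loop 1 fun _ => .seq (.pushes 2 [b]) (.pushes 3 [d])) (.move 2 1 fun _ => c)) (.clear 1)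

/-- The left symbols are stored on stack 1; each right symbol copies that stack to the output, with
stack 2 used to restore it. -/
theorem runs_mul [Finite (Γ 0)] [Finite (Γ 1)] [Finite (Γ 2)] (left : Γ 0 → Bool) (c : Γ 1)
    (b : Γ 2) (d : Γ 3)
    (x y : List (Γ 0)) (hx : ∀ a ∈ x, left a = true) (hy : ∀ a ∈ y, left a = false) :
    (mul left c b d).Runs (store (x ++ y) [] [] [])
      (store [] [] [] (.replicate (x.length * y.length) d))
      ((5 * (x.length + y.length) + 5) * (x.length + y.length) + 2 + (2 * x.length + 2)) := by
  let f : ℕ × ℕ → Γ 0 → ℕ × ℕ := fun s a =>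
    if left a then (s.1 + 1, s.2) else (s.1, s.2 + s.1)
  have h₀ : ∀ n m l, (loop 1 fun _ => .seq (.pushes 2 [b]) (.pushes 3 [d])).Runs
      (store (Γ := Γ) l (.replicate n c) [] (.replicate m d))
      (store l [] (.replicate n b) (.replicate (m + n) d)) (3 * n + 2) := by
    intro n m l
    have := runs_loop' (k := 1) (body := fun _ => .seq (.pushes 2 [b]) (.pushes 3 [d]))
      (fun s y => store (Γ := Γ) l y (.replicate s b) (.replicate (m + s) d)) (fun s _ => s + 1)
      (t := 2) (fun s l => rfl)
      (fun s a l' => by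
        have := (runs_pushes 2 [b] (store l l' (.replicate s b) (.replicate (m + s) d))).seq
          (runs_pushes 3 [d] _)
        simpa [List.replicate_succ, ← add_assoc] using this) (.replicate n c) 0
    simpa using this
  have h₁ := runs_loop (k := 0) (body := fun a => if left a then .pushes 1 [c] else
      .seq (.loop 1 fun _ => .seq (.pushes 2 [b]) (.pushes 3 [d])) (.move 2 1 fun _ => c))
    (fun s l => store l (.replicate s.1 c) [] (.replicate s.2 d)) f
    (t := 5 * (x.length + y.length) + 4) (fun s l => rfl)
    -- This bounds the number of tokens on stack 1, hence the `5 * n + 4` steps of copying and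
    -- restoring.
    (fun s l => s.1 + l.length ≤ x.length + y.length)
    (fun s a l h => by
      simp only [List.length_cons] at h
      simp only [f]
      split <;> simp only <;> omega)
    (fun s a l h => by
      obtain ⟨n, m⟩ := s
      simp only [List.length_cons] at h
      cases ha : left a
      · simp only [Bool.false_eq_true, if_false, update_store_zero]
        refine ((h₀ n m l).seq (runs_move (k := 2) (k' := 1) (t := 2 * n + 2) (by decide) _ ?_ ?_ ?_ ?_)).mono ?_
        · simp
        · simp [f, ha]
        · intro i h₁ h₂; fin_cases i <;> simp [f, ha] at h₁ h₂ ⊢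
        · simp
        · omega
      · have := runs_pushes 1 [c] (store l (.replicate n c) [] (.replicate m d))
        simpa [f, ha, List.replicate_succ] using this.mono (by omega)) (x ++ y) (0, 0) (by simp)
  have h₂ : ∀ x : List (Γ 0), (∀ a ∈ x, left a = true) → ∀ s : ℕ × ℕ, x.foldl f s = (s.1 + x.length, s.2) := by
    intro x hx
    induction x with
    | nil => simp
    | cons a x ih =>
      intro s
      rw [List.foldl_cons, ih fun a h => hx a (by simp [h])]
      simp [f, hx]
      omega
  have h₃ : ∀ x : List (Γ 0), (∀ a ∈ x, left a = false) → ∀ s : ℕ × ℕ, x.foldl f s = (s.1, s.2 + s.1 * x.length) := by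
    intro x hx
    induction x with
    | nil => simp
    | cons a x ih =>
      intro s
      rw [List.foldl_cons, ih fun a h => hx a (by simp [h])]
      simp [f, hx]
      ring
  rw [List.foldl_append, h₂ x hx, h₃ y hy] at h₁
  have h₄ := runs_clear (k := 1)
    (store (Γ := Γ) [] (.replicate x.length c) [] (.replicate (x.length * y.length) d))
  refine (Runs.seq (S₂ := _) (by simpa using h₁) (by simpa using h₄)).mono ?_
  exact le_of_eq (by ring)

end Machines

end StackProg

open StackProg

variable {α β A B : Type} {ea : Encoding α A} {eb : Encoding β B}

/-! ### A stock of polynomial-time functions -/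

theorem length_transduce_le {Q : Type} [Finite A] [Finite Q] (δ : Q → A → Q × List B)
    (fin : Q → List B) :
    ∃ c, ∀ q w, (transduce δ fin q w).length ≤ c * w.length + c := by
  obtain ⟨a, ha⟩ := (Set.finite_range fun s : Q × A => (δ s.1 s.2).2.length).bddAbove
  obtain ⟨b, hb⟩ := (Set.finite_range fun q => (fin q).length).bddAbove
  refine ⟨a + b, fun q w => ?_⟩
  induction w generalizing q with
  | nil => exact (hb ⟨q, rfl⟩).trans (by simp)
  | cons x w ih =>
    have h₁ : (δ q x).2.length ≤ a := ha ⟨(q, x), rfl⟩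
    have h₂ := ih (δ q x).1
    simp only [transduce, List.length_append, List.length_cons, mul_add, mul_one]
    omega

theorem PolyTime.of_store {f : α → β} [Finite A] {Γ : Fin 4 → Type} (i : A ≃ Γ 0) (o : B ≃ Γ 3)
    (P : StackProg Γ) (p : Polynomial ℕ)
    (h : ∀ a, P.Runs (store ((ea.encode a).map i) [] [] [])
      (store [] [] [] ((eb.encode (f a)).map o)) (p.eval (ea.encode a).length)) :
    PolyTime ea eb f := by
  refine .of_prog 0 3 i o P p fun a => ?_
  rw [← store_nil, update_store_zero, update_store_three]
  exact h a

theorem PolyTime.of_transduce_of_alphabets {Γ : Fin 4 → Type} [Finite (Γ 0)] [Finite (Γ 1)]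
    [Finite (Γ 2)] {ea : Encoding α (Γ 0)} {eb : Encoding β (Γ 3)} (δ : Γ 1 → Γ 0 → Γ 1 × List (Γ 2))
    (fin : Γ 1 → List (Γ 2)) (q : Γ 1) (g : Γ 2 → Γ 3) (f : α → β)
    (h : ∀ a, eb.encode (f a) = (transduce δ fin q (ea.encode a)).map g) : PolyTime ea eb f := by
  obtain ⟨c, hc⟩ := length_transduce_le δ fin
  refine .of_store (.refl _) (.refl _) (transducer δ fin q g)
    (.C 1 + (.C 4 * .X + .C 2) + .C 2 + (.C 2 * (.C c * .X + .C c) + .C 2)) fun a => ?_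
  rw [h, Equiv.coe_refl, Equiv.coe_refl, List.map_id, List.map_id]
  refine (runs_transducer _ δ fin q g).mono ?_
  simp only [Polynomial.eval_add, Polynomial.eval_mul, Polynomial.eval_C, Polynomial.eval_X]
  gcongr
  exact hc q _

/-- Finite-state transductions are polynomial-time computable. -/
theorem PolyTime.of_transduce {Q : Type} [Finite A] [Finite B] [Finite Q] (δ : Q → A → Q × List B)
    (fin : Q → List B) (q : Q) (f : α → β)
    (h : ∀ a, eb.encode (f a) = transduce δ fin q (ea.encode a)) : PolyTime ea eb f := by
  have : Finite ((![A, Q, B, B] : Fin 4 → Type) 0) := inferInstanceAs (Finite A)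
  have : Finite ((![A, Q, B, B] : Fin 4 → Type) 1) := inferInstanceAs (Finite Q)
  have : Finite ((![A, Q, B, B] : Fin 4 → Type) 2) := inferInstanceAs (Finite B)
  exact .of_transduce_of_alphabets (Γ := ![A, Q, B, B]) δ fin q id f fun a =>
    (h a).trans (List.map_id _).symm

theorem exists_alphabets (A B C D : Type) : ∃ Γ : Fin 4 → Type,
    Nonempty (A ≃ Γ 0) ∧ Nonempty (B ≃ Γ 1) ∧ Nonempty (C ≃ Γ 2) ∧ Nonempty (D ≃ Γ 3) :=
  ⟨![A, B, C, D], ⟨.refl _⟩, ⟨.refl _⟩, ⟨.refl _⟩, ⟨.refl _⟩⟩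

theorem polyTime_monus :
    PolyTime pairEnc strEnc fun u => .replicate (u.2.length - u.1.length) true := by
  obtain ⟨Γ, ⟨e₀⟩, ⟨e₁⟩, -, ⟨e₃⟩⟩ := exists_alphabets (Bool ⊕ Bool) Bool Bool Bool
  have : Finite (Γ 0) := .of_equiv _ e₀
  have : Finite (Γ 1) := .of_equiv _ e₁
  refine .of_store e₀ e₃ (monus (fun a => (e₀.symm a).isLeft) (e₁ true) (e₃ true))
    (.C 3 * .X + .C 2 + (.C 2 * .X + .C 2)) fun a => ?_
  have := runs_monus (fun a => (e₀.symm a).isLeft) (e₁ true) (e₃ true)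
    (a.1.map fun b => e₀ (.inl b)) (a.2.map fun b => e₀ (.inr b))
    (by simp only [List.mem_map]; rintro _ ⟨b, -, rfl⟩; simp)
    (by simp only [List.mem_map]; rintro _ ⟨b, -, rfl⟩; simp)
  convert this.mono ?_ using 2
  · simp [encodingProd, encodingList, Function.comp_def]
  · simp [encodingList]
  · simp [encodingProd, encodingList]

theorem polyTime_mul :
    PolyTime pairEnc strEnc fun u => .replicate (u.1.length * u.2.length) true := by
  obtain ⟨Γ, ⟨e₀⟩, ⟨e₁⟩, ⟨e₂⟩, ⟨e₃⟩⟩ := exists_alphabets (Bool ⊕ Bool) Bool Bool Bool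
  have : Finite (Γ 0) := .of_equiv _ e₀
  have : Finite (Γ 1) := .of_equiv _ e₁
  have : Finite (Γ 2) := .of_equiv _ e₂
  refine .of_store e₀ e₃ (mul (fun a => (e₀.symm a).isLeft) (e₁ true) (e₂ true) (e₃ true))
    ((.C 5 * .X + .C 5) * .X + .C 2 + (.C 2 * .X + .C 2)) fun a => ?_
  have := runs_mul (fun a => (e₀.symm a).isLeft) (e₁ true) (e₂ true) (e₃ true)
    (a.1.map fun b => e₀ (.inl b)) (a.2.map fun b => e₀ (.inr b))
    (by simp only [List.mem_map]; rintro _ ⟨b, -, rfl⟩; simp)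
    (by simp only [List.mem_map]; rintro _ ⟨b, -, rfl⟩; simp)
  convert this.mono ?_ using 2
  · simp [encodingProd, encodingList, Function.comp_def]
  · simp [encodingList]
  · simp [encodingProd, encodingList]

theorem PolyTime.of_flatMap [Finite A] [Finite B] (h : A → List B) (w : List B) (f : α → β)
    (hf : ∀ a, eb.encode (f a) = (ea.encode a).flatMap h ++ w) : PolyTime ea eb f := by
  refine .of_transduce (Q := Unit) (fun _ a => ((), h a)) (fun _ => w) () _ fun a => ?_
  rw [hf]
  induction ea.encode a with
  | nil => rfl
  | cons x l ih => rw [List.flatMap_cons, List.append_assoc, ih, transduce]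

theorem polyTime_const [Finite A] [Finite B] (b : β) : PolyTime ea eb fun _ => b :=
  .of_flatMap (fun _ => []) (eb.encode b) _ fun a => by simp

theorem polyTime_id [Finite A] : PolyTime ea ea fun a => a :=
  have := Fintype.ofFinite A
  ⟨idComputableInPolyTime ea.encode⟩

theorem polyTime_fst : PolyTime pairEnc strEnc Prod.fst :=
  .of_flatMap (Sum.elim (fun b => [b]) fun _ => []) [] _ fun a => by
    simp [encodingProd, encodingList, List.flatMap_map]

theorem polyTime_snd : PolyTime pairEnc strEnc Prod.snd :=
  .of_flatMap (Sum.elim (fun _ => []) fun b => [b]) [] _ fun a => by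
    simp [encodingProd, encodingList, List.flatMap_map]

/-- A pair is presented as one marked word; erasing the marks concatenates. -/
theorem polyTime_append : PolyTime pairEnc strEnc fun u => u.1 ++ u.2 :=
  .of_flatMap (Sum.elim (fun b => [b]) fun b => [b]) [] _ fun a => by
    simp [encodingProd, encodingList, List.flatMap_map]

theorem polyTime_cons (b : Bool) : PolyTime strEnc strEnc (List.cons b) :=
  polyTime_append.comp ((polyTime_const [b]).prodMk polyTime_id)

theorem polyTime_isEmpty : PolyTime strEnc encodingBoolBool List.isEmpty := by
  refine .of_transduce (fun _ _ => (false, [])) (fun q => [q]) true _ fun a => ?_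
  suffices ∀ (a : Str) q, transduce (fun (_ _ : Bool) => (false, ([] : List Bool))) (fun q => [q]) q a =
      [q && a.isEmpty] from (this a true).symm
  intro a
  induction a with
  | nil => simp [transduce]
  | cons x l ih => simp [transduce, ih]

theorem polyTime_and :
    PolyTime (encodingProd encodingBoolBool encodingBoolBool) encodingBoolBool
      fun u => u.1 && u.2 :=
  .of_transduce (fun q a => (q && a.elim id id, [])) (fun q => [q]) true _ fun _ => rfl

/-- The shape of the one-way function in `exists_oneWay`. The first symbol read becomes the state,
which decides whether the rest is copied. -/
theorem polyTime_guard :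
    PolyTime (encodingProd encodingBoolBool strEnc) strEnc
      fun u => if u.1 then true :: u.2 else [] := by
  let δ : Bool → Bool ⊕ Bool → Bool × List Bool := fun q a =>
    a.elim (fun b => (b, if b then [true] else [])) fun b => (q, if q then [b] else [])
  have h : ∀ q (a : Str), transduce δ (fun _ => []) q (a.map Sum.inr) = if q then a else [] := by
    intro q a
    induction a with
    | nil => simp [transduce]
    | cons x l ih =>
      simp only [List.map_cons, transduce, δ, Sum.elim_inr] at ih ⊢
      rw [ih]
      cases q <;> rfl
  refine .of_transduce δ (fun _ => []) true _ fun ⟨b, a⟩ => ?_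
  change _ = transduce δ _ true (Sum.inl b :: a.map Sum.inr)
  rw [transduce, h]
  cases b <;> rfl

/-- Polynomials can be evaluated in unary in polynomial time. -/
theorem polyTime_unary (q : Polynomial ℕ) :
    PolyTime strEnc strEnc fun x => .replicate (q.eval x.length) true := by
  induction q using Polynomial.induction_on with
  | C a => simp only [Polynomial.eval_C]; exact polyTime_const _
  | add p q hp hq =>
    simp only [Polynomial.eval_add, List.replicate_add]
    exact polyTime_append.comp (hp.prodMk hq)
  | monomial n a h =>
    convert polyTime_mul.comp (h.prodMk polyTime_id) using 3
    rw [List.length_replicate, pow_succ, ← mul_assoc, Polynomial.eval_mul, Polynomial.eval_X]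

/-- The length of one string can be compared with a polynomial in the length of another one. -/
theorem polyTime_length_le (q : Polynomial ℕ) : PolyTime pairEnc encodingBoolBool
    fun u => decide (u.2.length ≤ q.eval u.1.length) := by
  -- The comparison holds exactly when the truncated difference, written in unary, is empty.
  have := polyTime_isEmpty.comp
    (polyTime_monus.comp (((polyTime_unary q).comp polyTime_fst).prodMk polyTime_snd))
  convert this using 2 with u
  rw [List.length_replicate, Bool.eq_iff_iff, decide_eq_true_iff, List.isEmpty_iff,
    List.replicate_eq_nil_iff, Nat.sub_eq_zero_iff_le]

/-! ### One-way functions from P ≠ NP -/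

theorem classP_subset_classNP : ClassP ⊆ ClassNP := by
  rintro L ⟨d, hd, hL⟩
  refine ⟨{u | u.1 ∈ L}, ⟨fun u => d u.1, hd.comp polyTime_fst, fun u => hL u.1⟩, 0, fun x => ?_⟩
  exact ⟨fun h => ⟨[], by simp, h⟩, fun ⟨_, _, h⟩ => h⟩

/-- One-way functions exist if P is not NP. -/
theorem exists_oneWay (hPNP : ClassP ≠ ClassNP) : ∃ ρ, OneWay ρ := by
  obtain ⟨L, ⟨R, ⟨d, hd, hR⟩, q, hL⟩, hLP⟩ : ∃ L ∈ ClassNP, L ∉ ClassP := by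
    by_contra! h
    exact hPNP (classP_subset_classNP.antisymm h)
  -- With the length bound built into the test, every accepted witness is short, which gives
  -- honesty.
  let c : Str × Str → Bool := fun u => d u && decide (u.2.length ≤ q.eval u.1.length)
  have hc : PolyTime pairEnc encodingBoolBool c := polyTime_and.comp (hd.prodMk (polyTime_length_le q))
  have hcL : ∀ x, x ∈ L ↔ ∃ w, c (x, w) = true := by
    intro x
    simp only [hL, c, hR, Bool.and_eq_true, decide_eq_true_iff]
    exact exists_congr fun w => and_comm
  -- The leading `true` keeps accepted values apart from the default `[]`.
  let ρ : Str × Str → Str := fun u => if c u then true :: u.1 else []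
  have hρ : ∀ u x, ρ u = true :: x ↔ c u = true ∧ u.1 = x := by
    intro u x
    by_cases h : c u = true <;> simp [ρ, h]
  refine ⟨ρ, ⟨?_, ?_, ?_⟩⟩
  · have hlen : ∀ x w, c (x, w) = true →
        x.length + w.length ≤ (.X + q : Polynomial ℕ).eval (ρ (x, w)).length := by
      intro x w hw
      have h := (hρ _ _).2 ⟨hw, rfl⟩
      simp only [c, Bool.and_eq_true, decide_eq_true_iff] at hw
      have := q.eval_mono_nat (Nat.le_add_right x.length 1)
      simp only [h, List.length_cons, Polynomial.eval_add, Polynomial.eval_X]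
      omega
    -- If the default value is attained, one fixed preimage of it serves, and its length enters the
    -- bound as a constant.
    by_cases h : ∃ u, ρ u = []
    · obtain ⟨⟨a, b⟩, hu⟩ := h
      refine ⟨.X + q + .C (a.length + b.length), ?_⟩
      rintro z ⟨⟨x, w⟩, rfl⟩
      rw [Polynomial.eval_add, Polynomial.eval_C]
      by_cases hw : c (x, w) = true
      · exact ⟨x, w, (hlen x w hw).trans (Nat.le_add_right _ _), rfl⟩
      · exact ⟨a, b, Nat.le_add_left _ _, hu.trans (by simp [ρ, hw])⟩
    · refine ⟨.X + q, ?_⟩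
      rintro z ⟨⟨x, w⟩, rfl⟩
      refine ⟨x, w, hlen x w ?_, rfl⟩
      by_contra hw
      exact h ⟨(x, w), by simp [ρ, hw]⟩
  · exact polyTime_guard.comp (hc.prodMk polyTime_fst)
  · rintro ⟨g, hg, hgρ⟩
    refine hLP ⟨fun x => c (x, (g (true :: x)).2), ?_, fun x => ⟨fun hx => ?_, fun hx => ?_⟩⟩
    · exact hc.comp (polyTime_id.prodMk (polyTime_snd.comp (hg.comp (polyTime_cons true))))
    · obtain ⟨w, hw⟩ := (hcL x).1 hx
      obtain ⟨h₁, h₂⟩ := (hρ _ _).1 (hgρ (true :: x) ⟨(x, w), (hρ _ _).2 ⟨hw, rfl⟩⟩)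
      -- A preimage of `true :: x` necessarily has first component `x`.
      have : (x, (g (true :: x)).2) = g (true :: x) := Prod.ext h₂.symm rfl
      exact (congrArg c this).trans h₁
    · exact (hcL x).2 ⟨_, hx⟩

/-! ### Transfer along the pairing function -/

namespace PairingFunction

variable (p : PairingFunction)

theorem polyTime_symm : PolyTime strEnc pairEnc p.toEquiv.symm :=
  p.polyTime_fst.prodMk p.polyTime_snd

theorem exists_length_pair_le : ∃ q : Polynomial ℕ, ∀ a b : Str,
    (p.toEquiv (a, b)).length ≤ q.eval (a.length + b.length) := by
  obtain ⟨q, hq⟩ := p.polyTime_pair.exists_length_le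
  exact ⟨q, fun a b => by simpa [encodingProd, encodingList] using hq (a, b)⟩

/-- Short preimages of a one-way function yield short codes of preimages. -/
theorem exists_preimage {ρ : Str × Str → Str} (hρ : Honest ρ) : ∃ q : Polynomial ℕ,
    ∀ z ∈ Set.range ρ, ∃ c : Str, c.length ≤ q.eval z.length ∧ ρ (p.toEquiv.symm c) = z := by
  obtain ⟨r, hr⟩ := hρ
  obtain ⟨s, hs⟩ := p.exists_length_pair_le
  refine ⟨s.comp r, fun z hz => ?_⟩
  obtain ⟨a, b, hab, h⟩ := hr z hz
  refine ⟨p.toEquiv (a, b), ?_, by simpa⟩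
  rw [Polynomial.eval_comp]
  exact (hs a b).trans (s.eval_mono_nat hab)

/-- Decoding is polynomial-time, so finding codes of preimages is as hard as finding preimages. -/
theorem noninvertible_comp {ρ : Str × Str → Str} (hρ : Noninvertible ρ) {g : Str → Str}
    (hg : PolyTime strEnc strEnc g) : ¬ ∀ z ∈ Set.range ρ, ρ (p.toEquiv.symm (g z)) = z :=
  fun h => hρ ⟨fun z => p.toEquiv.symm (g z), p.polyTime_symm.comp hg, h⟩

theorem polyTime_pair_nil : PolyTime strEnc strEnc (p.pair []) :=
  p.polyTime_pair.comp ((polyTime_const (eb := strEnc) []).prodMk polyTime_id)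

end PairingFunction

/-- Decoding is surjective, so the image is that of `ρ`. The ignored argument may be `[]`: it
inverts trivially, and fixing it turns any other inverter into one that finds codes of
`ρ`-preimages. -/
theorem oneWay_comp_snd (p : PairingFunction) {ρ : Str × Str → Str} (hρ : OneWay ρ) :
    SHonest (fun u => ρ (p.toEquiv.symm u.2)) ∧ OneWay (fun u => ρ (p.toEquiv.symm u.2)) ∧
      InvertibleSecond p (fun u => ρ (p.toEquiv.symm u.2)) ∧
      ¬ InvertibleFirst p (fun u => ρ (p.toEquiv.symm u.2)) ∧
      ¬ StronglyOneWay p (fun u => ρ (p.toEquiv.symm u.2)) := by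
  obtain ⟨q, hq⟩ := p.exists_preimage hρ.1
  have hs : InvertibleSecond p (fun u => ρ (p.toEquiv.symm u.2)) :=
    ⟨fun _ => [], polyTime_const _, fun _ _ _ _ h => h⟩
  refine ⟨⟨q, ?_, ?_⟩, ⟨⟨q, ?_⟩, ?_, ?_⟩, hs, ?_, fun h => h.2.2.2 hs⟩
  · rintro z a ⟨b, rfl⟩
    obtain ⟨c, hc, h⟩ := hq _ ⟨p.toEquiv.symm b, rfl⟩
    exact ⟨c, hc.trans (q.eval_mono_nat (Nat.le_add_right _ _)), h⟩
  · rintro z b ⟨a, rfl⟩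
    exact ⟨[], Nat.zero_le _, rfl⟩
  · rintro z ⟨u, rfl⟩
    obtain ⟨c, hc, h⟩ := hq _ ⟨p.toEquiv.symm u.2, rfl⟩
    exact ⟨[], c, by simpa using hc, h⟩
  · exact hρ.2.1.comp (p.polyTime_symm.comp polyTime_snd)
  · rintro ⟨g, hg, h⟩
    refine p.noninvertible_comp hρ.2.2 (polyTime_snd.comp hg) ?_
    rintro z ⟨u, rfl⟩
    exact h _ ⟨([], p.toEquiv u), by simp⟩
  · rintro ⟨g, hg, h⟩
    refine p.noninvertible_comp hρ.2.2 (hg.comp p.polyTime_pair_nil) ?_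
    rintro z ⟨u, rfl⟩
    exact h _ ⟨([], p.toEquiv u), by simp⟩ [] (p.toEquiv u) (by simp)

/-- The mirror image of `oneWay_comp_snd`, with the second argument ignored. -/
theorem oneWay_comp_fst (p : PairingFunction) {ρ : Str × Str → Str} (hρ : OneWay ρ) :
    SHonest (fun u => ρ (p.toEquiv.symm u.1)) ∧ OneWay (fun u => ρ (p.toEquiv.symm u.1)) ∧
      InvertibleFirst p (fun u => ρ (p.toEquiv.symm u.1)) ∧
      ¬ InvertibleSecond p (fun u => ρ (p.toEquiv.symm u.1)) ∧
      ¬ StronglyOneWay p (fun u => ρ (p.toEquiv.symm u.1)) := by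
  obtain ⟨q, hq⟩ := p.exists_preimage hρ.1
  have hs : InvertibleFirst p (fun u => ρ (p.toEquiv.symm u.1)) :=
    ⟨fun _ => [], polyTime_const _, fun _ _ _ _ h => h⟩
  refine ⟨⟨q, ?_, ?_⟩, ⟨⟨q, ?_⟩, ?_, ?_⟩, hs, ?_, fun h => h.2.2.1 hs⟩
  · rintro z a ⟨b, rfl⟩
    exact ⟨[], Nat.zero_le _, rfl⟩
  · rintro z b ⟨a, rfl⟩
    obtain ⟨c, hc, h⟩ := hq _ ⟨p.toEquiv.symm a, rfl⟩
    exact ⟨c, hc.trans (q.eval_mono_nat (Nat.le_add_right _ _)), h⟩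
  · rintro z ⟨u, rfl⟩
    obtain ⟨c, hc, h⟩ := hq _ ⟨p.toEquiv.symm u.1, rfl⟩
    exact ⟨c, [], by simpa using hc, h⟩
  · exact hρ.2.1.comp (p.polyTime_symm.comp polyTime_fst)
  · rintro ⟨g, hg, h⟩
    refine p.noninvertible_comp hρ.2.2 (polyTime_fst.comp hg) ?_
    rintro z ⟨u, rfl⟩
    exact h _ ⟨(p.toEquiv u, []), by simp⟩
  · rintro ⟨g, hg, h⟩
    refine p.noninvertible_comp hρ.2.2 (hg.comp p.polyTime_pair_nil) ?_
    rintro z ⟨u, rfl⟩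
    exact h _ ⟨(p.toEquiv u, []), by simp⟩ (p.toEquiv u) [] (by simp)

theorem theorem3p6 (hPNP : ClassP ≠ ClassNP) (p : PairingFunction) :
    (∃ σ : Str × Str → Str, SHonest σ ∧ OneWay σ ∧
      InvertibleFirst p σ ∧ ¬ InvertibleSecond p σ ∧ ¬ StronglyOneWay p σ) ∧
    (∃ σ : Str × Str → Str, SHonest σ ∧ OneWay σ ∧
      InvertibleSecond p σ ∧ ¬ InvertibleFirst p σ ∧ ¬ StronglyOneWay p σ) ∧
    (∀ ρ : Str × Str → Str, OneWay ρ →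
      ∀ σ : Str × Str → Str, (∀ a b : Str, σ (a, b) = ρ (p.proj₁ b, p.proj₂ b)) →
        SHonest σ ∧ OneWay σ ∧
          InvertibleSecond p σ ∧ ¬ InvertibleFirst p σ ∧ ¬ StronglyOneWay p σ) := by
  obtain ⟨ρ, hρ⟩ := exists_oneWay hPNP
  refine ⟨⟨_, oneWay_comp_fst p hρ⟩, ⟨_, oneWay_comp_snd p hρ⟩, fun ρ hρ σ hσ => ?_⟩
  obtain rfl : σ = fun u => ρ (p.toEquiv.symm u.2) := funext fun u => hσ u.1 u.2
  exact oneWay_comp_snd p hρ
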